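/- Let $K$ be a field of characteristic zero and let $\mathfrak L$ be a Lie algebra over $K$ (of arbitrary dimension), with universal enveloping algebra $U\mathfrak L$, a cocommutative Hopf algebra in which the elements of $\mathfrak L$ are primitive. Let $(U\mathfrak L)^\circ$ be its Hopf dual: the commutative Hopf algebra of all linear functionals $U\mathfrak L\to K$ that vanish on some two-sided ideal of finite codimension, with product, coproduct, unit, counit and antipode transposed from those of $U\mathfrak L$. Let $\mathbf G(\mathfrak L)=\mathrm{Spec}\,(U\mathfrak L)^\circ$ be the resulting affine group scheme over $K$ (the affine envelope of $\mathfrak L$). A morphism $G\to H$ of affine group schemes over $K$ is called a quotient morphism if the induced map $\mathcal O(H)\to\mathcal O(G)$ is injective (equivalently, if it is faithfully flat). An algebraic group scheme is an affine group scheme of finite type over $K$. An affine group scheme is called pro-connected if it is the limit of a projective system, indexed by a non-empty directed set, of connected algebraic group schemes whose transition morphisms are quotient morphisms. Then: (1) for every algebraic group scheme $G$ over $K$ and every quotient morphism $\mathbf G(\mathfrak L)\to G$, the group scheme $G$ is connected; (2) $\mathbf G(\mathfrak L)$ is pro-connected. -/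

import Mathlib

universe u

noncomputable section

open TensorProduct WithConv

attribute [local instance 100] LieRing.ofAssociativeRing

/-! The universal enveloping algebra as a cocommutative Hopf algebra. -/

namespace UniversalEnvelopingAlgebra

variable (K : Type*) [Field K] (L : Type*) [LieRing L] [LieAlgebra K L]

/-- The comultiplication, determined by `Δ x = x ⊗ 1 + 1 ⊗ x` for `x` in `L`. -/
def comulHom : UniversalEnvelopingAlgebra K L →ₐ[K]
    UniversalEnvelopingAlgebra K L ⊗[K] UniversalEnvelopingAlgebra K L :=
  lift K
    { toFun := fun x => ι K x ⊗ₜ[K] 1 + 1 ⊗ₜ[K] ι K x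
      map_add' := fun x y => by
        rw [map_add, TensorProduct.add_tmul, TensorProduct.tmul_add]; abel
      map_smul' := fun c x => by
        rw [map_smul, ← TensorProduct.smul_tmul', TensorProduct.tmul_smul, RingHom.id_apply, smul_add]
      map_lie' := fun {x y} => by
        simp only [LieHom.map_lie, LieRing.of_associative_ring_bracket, add_mul, mul_add,
          Algebra.TensorProduct.tmul_mul_tmul, one_mul, mul_one, TensorProduct.sub_tmul,
          TensorProduct.tmul_sub]
        abel }

/-- The counit, determined by `ε x = 0` for `x` in `L`. -/
def counitHom : UniversalEnvelopingAlgebra K L →ₐ[K] K :=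
  lift K 0

/-- The antipode as an algebra map to the opposite algebra, determined by `S x = -x` for
`x` in `L`. -/
def antipodeHom : UniversalEnvelopingAlgebra K L →ₐ[K] (UniversalEnvelopingAlgebra K L)ᵐᵒᵖ :=
  lift K
    { toFun := fun x => MulOpposite.op (-ι K x)
      map_add' := fun x y => by
        rw [map_add, neg_add, MulOpposite.op_add]
      map_smul' := fun c x => by
        rw [map_smul, ← smul_neg, MulOpposite.op_smul, RingHom.id_apply]
      map_lie' := fun {x y} => by
        simp only [LieHom.map_lie, LieRing.of_associative_ring_bracket, ← MulOpposite.op_mul,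
          ← MulOpposite.op_sub, neg_mul_neg, neg_sub] }

variable {L}

theorem comulHom_ι (x : L) : comulHom K L (ι K x) = ι K x ⊗ₜ[K] 1 + 1 ⊗ₜ[K] ι K x := by
  rw [comulHom, lift_ι_apply]; rfl

theorem counitHom_ι (x : L) : counitHom K L (ι K x) = 0 := by
  rw [counitHom, lift_ι_apply]; rfl

theorem antipodeHom_ι (x : L) : antipodeHom K L (ι K x) = MulOpposite.op (-ι K x) := by
  rw [antipodeHom, lift_ι_apply]; rfl

theorem algHom_ext_ι {A : Type*} [Ring A] [Algebra K A]
    {f g : UniversalEnvelopingAlgebra K L →ₐ[K] A} (h : ∀ x : L, f (ι K x) = g (ι K x)) : f = g :=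
  hom_ext K (LieHom.ext h)

variable (L)

instance instBialgebra : Bialgebra K (UniversalEnvelopingAlgebra K L) :=
  Bialgebra.ofAlgHom (comulHom K L) (counitHom K L)
    (algHom_ext_ι K fun x => by
      simp [-ι_apply, comulHom_ι, TensorProduct.add_tmul, TensorProduct.tmul_add,
        Algebra.TensorProduct.one_def]
      abel)
    (algHom_ext_ι K fun x => by
      simp [-ι_apply, comulHom_ι, counitHom_ι])
    (algHom_ext_ι K fun x => by
      simp [-ι_apply, comulHom_ι, counitHom_ι])

variable {L}

theorem comul_ι (x : L) :
    Coalgebra.comul (R := K) (ι K x) = ι K x ⊗ₜ[K] 1 + 1 ⊗ₜ[K] ι K x :=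
  comulHom_ι K x

theorem counit_ι (x : L) : Coalgebra.counit (R := K) (ι K x) = 0 :=
  counitHom_ι K x

variable (L)

instance instIsCocomm : Coalgebra.IsCocomm K (UniversalEnvelopingAlgebra K L) where
  comm_comp_comul := by
    have h : (Algebra.TensorProduct.comm K (UniversalEnvelopingAlgebra K L)
        (UniversalEnvelopingAlgebra K L)).toAlgHom.comp (Bialgebra.comulAlgHom K _) =
        Bialgebra.comulAlgHom K (UniversalEnvelopingAlgebra K L) :=
      algHom_ext_ι K fun x => by
        simp [-ι_apply, comul_ι]
        abel
    exact congr(($h).toLinearMap)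

/-- The antipode as a linear map. -/
def antipodeLin : UniversalEnvelopingAlgebra K L →ₗ[K] UniversalEnvelopingAlgebra K L :=
  (MulOpposite.opLinearEquiv K).symm.toLinearMap ∘ₗ (antipodeHom K L).toLinearMap

variable {L}

theorem antipodeLin_one : antipodeLin K L 1 = 1 := by simp [antipodeLin]

theorem antipodeLin_mul (u v : UniversalEnvelopingAlgebra K L) :
    antipodeLin K L (u * v) = antipodeLin K L v * antipodeLin K L u := by simp [antipodeLin]

theorem antipodeLin_ι (x : L) : antipodeLin K L (ι K x) = -ι K x := by
  simp [-ι_apply, antipodeLin, antipodeHom_ι]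

@[elab_as_elim]
theorem induction_left {P : UniversalEnvelopingAlgebra K L → Prop} (one : P 1)
    (add : ∀ u v, P u → P v → P (u + v)) (smul : ∀ (c : K) u, P u → P (c • u))
    (mul : ∀ (x : L) u, P u → P (ι K x * u)) (u : UniversalEnvelopingAlgebra K L) : P u := by
  let M : Submodule K (UniversalEnvelopingAlgebra K L) :=
    { carrier := {u | P u}
      add_mem' := fun {a b} ha hb => add a b ha hb
      zero_mem' := by simpa using smul 0 1 one
      smul_mem' := fun c {a} ha => smul c a ha }
  let A : Subalgebra K (UniversalEnvelopingAlgebra K L) :=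
    { carrier := {w | ∀ u ∈ M, w * u ∈ M}
      mul_mem' := fun {a b} ha hb u hu => by rw [mul_assoc]; exact ha _ (hb u hu)
      add_mem' := fun {a b} ha hb u hu => by rw [add_mul]; exact M.add_mem (ha u hu) (hb u hu)
      algebraMap_mem' := fun r u hu => by
        rw [← Algebra.smul_def]; exact M.smul_mem r hu }
  let f : UniversalEnvelopingAlgebra K L →ₐ[K] A := lift K
    { toFun := fun x => ⟨ι K x, fun u hu => mul x u hu⟩
      map_add' := fun x y => by ext; simp
      map_smul' := fun c x => by ext; simp
      map_lie' := fun {x y} => by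
        ext; simp [-ι_apply, LieRing.of_associative_ring_bracket] }
  have hf : A.val.comp f = AlgHom.id K _ := algHom_ext_ι K fun x => by
    simp only [AlgHom.comp_apply, f, lift_ι_apply]; rfl
  have h : u ∈ A := by
    have := congr($hf u)
    simp only [AlgHom.comp_apply, AlgHom.id_apply] at this
    rw [← this]; exact (f u).2
  have := h 1 one
  rwa [mul_one] at this

theorem mul'_rTensor_antipodeLin (u : UniversalEnvelopingAlgebra K L) :
    LinearMap.mul' K _ ((antipodeLin K L).rTensor _ (Coalgebra.comul (R := K) u)) =
      algebraMap K _ (Coalgebra.counit (R := K) u) := by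
  induction u using induction_left K with
  | one => simp [Algebra.TensorProduct.one_def, antipodeLin_one]
  | add u v hu hv => simp only [map_add, hu, hv]
  | smul c u hu => simp only [map_smul, hu, smul_eq_mul, Algebra.algebraMap_eq_smul_one, mul_smul]
  | mul x u hu =>
    have key : ∀ t : UniversalEnvelopingAlgebra K L ⊗[K] UniversalEnvelopingAlgebra K L,
        LinearMap.mul' K _ ((antipodeLin K L).rTensor _
          ((ι K x ⊗ₜ[K] 1 + 1 ⊗ₜ[K] ι K x) * t)) = 0 := fun t => by
      induction t using TensorProduct.induction_on with
      | zero => simp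
      | add s t hs ht => rw [mul_add, map_add, map_add, hs, ht, add_zero]
      | tmul a b =>
        rw [add_mul, Algebra.TensorProduct.tmul_mul_tmul, Algebra.TensorProduct.tmul_mul_tmul,
          map_add, map_add, LinearMap.rTensor_tmul, LinearMap.rTensor_tmul,
          LinearMap.mul'_apply, LinearMap.mul'_apply, antipodeLin_mul, antipodeLin_ι]
        simp only [one_mul, mul_neg, neg_mul, mul_assoc, neg_add_cancel]
    rw [Bialgebra.comul_mul, Bialgebra.counit_mul, comul_ι, counit_ι, key, zero_mul, map_zero]

theorem mul'_lTensor_antipodeLin (u : UniversalEnvelopingAlgebra K L) :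
    LinearMap.mul' K _ ((antipodeLin K L).lTensor _ (Coalgebra.comul (R := K) u)) =
      algebraMap K _ (Coalgebra.counit (R := K) u) := by
  induction u using induction_left K with
  | one => simp [Algebra.TensorProduct.one_def, antipodeLin_one]
  | add u v hu hv => simp only [map_add, hu, hv]
  | smul c u hu => simp only [map_smul, hu, smul_eq_mul, Algebra.algebraMap_eq_smul_one, mul_smul]
  | mul x u hu =>
    have key : ∀ t : UniversalEnvelopingAlgebra K L ⊗[K] UniversalEnvelopingAlgebra K L,
        LinearMap.mul' K _ ((antipodeLin K L).lTensor _
          ((ι K x ⊗ₜ[K] 1 + 1 ⊗ₜ[K] ι K x) * t)) =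
        ι K x * LinearMap.mul' K _ ((antipodeLin K L).lTensor _ t) -
          LinearMap.mul' K _ ((antipodeLin K L).lTensor _ t) * ι K x := fun t => by
      induction t using TensorProduct.induction_on with
      | zero => simp
      | add s t hs ht => rw [mul_add, map_add, map_add, hs, ht, map_add, map_add]; noncomm_ring
      | tmul a b =>
        rw [add_mul, Algebra.TensorProduct.tmul_mul_tmul, Algebra.TensorProduct.tmul_mul_tmul,
          map_add, map_add, LinearMap.lTensor_tmul, LinearMap.lTensor_tmul, LinearMap.lTensor_tmul,
          LinearMap.mul'_apply, LinearMap.mul'_apply, LinearMap.mul'_apply, one_mul b, antipodeLin_mul,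
          antipodeLin_ι]
        simp only [one_mul, mul_neg, mul_assoc, sub_eq_add_neg]
    rw [Bialgebra.comul_mul, Bialgebra.counit_mul, comul_ι, counit_ι, key, hu, zero_mul, map_zero,
      Algebra.commutes, sub_self]

variable (L)

instance instHopfAlgebra : HopfAlgebra K (UniversalEnvelopingAlgebra K L) where
  antipode := antipodeLin K L
  mul_antipode_rTensor_comul := LinearMap.ext (mul'_rTensor_antipodeLin K)
  mul_antipode_lTensor_comul := LinearMap.ext (mul'_lTensor_antipodeLin K)

end UniversalEnvelopingAlgebra

end

/-! The finite dual of a cocommutative bialgebra. -/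

noncomputable section

open TensorProduct WithConv

variable {K : Type*} [Field K] {H : Type*} [Ring H]

section
variable [Algebra K H]

/-- A functional on `H` is representative if it vanishes on a two-sided ideal of finite
codimension. -/
def IsRepresentative (f : H →ₗ[K] K) : Prop :=
  ∃ I : Ideal H, I.IsTwoSided ∧ FiniteDimensional K (H ⧸ I) ∧ ∀ x ∈ I, f x = 0

theorem isRepresentative_comp {A : Type*} [Ring A] [Algebra K A] [FiniteDimensional K A]
    (φ : H →ₐ[K] A) (g : A →ₗ[K] K) : IsRepresentative (g ∘ₗ φ.toLinearMap) := by
  refine ⟨RingHom.ker φ, inferInstance, ?_, fun x hx => ?_⟩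
  · exact FiniteDimensional.of_injective (Ideal.kerLiftAlg φ).toLinearMap
      (Ideal.kerLiftAlg_injective φ)
  · rw [LinearMap.comp_apply, AlgHom.toLinearMap_apply, (RingHom.mem_ker).mp hx, map_zero]

theorem IsRepresentative.exists_eq {f : H →ₗ[K] K} (hf : IsRepresentative f) :
    ∃ (I : Ideal H) (_ : I.IsTwoSided) (_ : FiniteDimensional K (H ⧸ I)) (g : (H ⧸ I) →ₗ[K] K),
      f = g ∘ₗ (Ideal.Quotient.mkₐ K I).toLinearMap := by
  obtain ⟨I, hI, hfin, h⟩ := hf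
  refine ⟨I, hI, hfin, (I.restrictScalars K).liftQ f fun x hx => h x hx, ?_⟩
  rfl

/-- The transpose of an anti-endomorphism of `H` preserves the representative functionals. -/
theorem isRepresentative_antipode (S : H →ₐ[K] Hᵐᵒᵖ) {f : H →ₗ[K] K} (hf : IsRepresentative f) :
    IsRepresentative
      (f ∘ₗ ((MulOpposite.opLinearEquiv K).symm.toLinearMap ∘ₗ S.toLinearMap)) := by
  obtain ⟨I, _, _, g, rfl⟩ := hf.exists_eq
  exact isRepresentative_comp ((AlgHom.op (Ideal.Quotient.mkₐ K I)).comp S)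
    (g ∘ₗ (MulOpposite.opLinearEquiv K).symm.toLinearMap)

end

variable [Bialgebra K H]

variable (K H) in
/-- The representative functionals form a subalgebra of the linear dual of `H` with the convolution
product `(f * g)(u) = ∑ f(u₁) g(u₂)`. -/
def representativeSubalgebra : Subalgebra K (WithConv (H →ₗ[K] K)) where
  carrier := {f | IsRepresentative f.ofConv}
  mul_mem' {f g} hf hg := by
    obtain ⟨I, _, _, a, ha⟩ := IsRepresentative.exists_eq hf
    obtain ⟨J, _, _, b, hb⟩ := IsRepresentative.exists_eq hg
    have := isRepresentative_comp ((Algebra.TensorProduct.map (Ideal.Quotient.mkₐ K I)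
      (Ideal.Quotient.mkₐ K J)).comp (Bialgebra.comulAlgHom K H))
      (LinearMap.mul' K K ∘ₗ TensorProduct.map a b)
    show IsRepresentative (f * g).ofConv
    convert this using 1
    rw [LinearMap.convMul_def, ha, hb, TensorProduct.map_comp]
    rfl
  add_mem' {f g} hf hg := by
    obtain ⟨I, _, _, a, ha⟩ := IsRepresentative.exists_eq hf
    obtain ⟨J, _, _, b, hb⟩ := IsRepresentative.exists_eq hg
    have := isRepresentative_comp ((Ideal.Quotient.mkₐ K I).prod (Ideal.Quotient.mkₐ K J))
      (a.coprod b)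
    show IsRepresentative (f + g).ofConv
    convert this using 1
    rw [ofConv_add, ha, hb]
    rfl
  algebraMap_mem' r := by
    have := isRepresentative_comp (Bialgebra.counitAlgHom K H) (r • LinearMap.id)
    show IsRepresentative (algebraMap K (WithConv (H →ₗ[K] K)) r).ofConv
    convert this using 1
    ext u
    simp [Algebra.algebraMap_eq_smul_one, LinearMap.convOne_def]

variable [Coalgebra.IsCocomm K H]

variable (K H) in
/-- The finite dual (Hopf dual, Sweedler dual) `H°` of a cocommutative bialgebra `H`: the
commutative algebra of representative functionals on `H`. -/
def FiniteDual : Type _ := representativeSubalgebra K H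

instance : CommRing (FiniteDual K H) :=
  inferInstanceAs (CommRing (representativeSubalgebra K H))

instance : Algebra K (FiniteDual K H) :=
  inferInstanceAs (Algebra K (representativeSubalgebra K H))

namespace FiniteDual

variable (K H) in
/-- The inclusion of the finite dual into the linear dual. -/
def incl : FiniteDual K H →ₗ[K] (H →ₗ[K] K) where
  toFun f := f.1.ofConv
  map_add' _ _ := rfl
  map_smul' _ _ := rfl

theorem incl_injective : Function.Injective (incl K H) := fun _ _ h =>
  Subtype.ext (ofConv_injective h)

theorem isRepresentative_incl (f : FiniteDual K H) : IsRepresentative (incl K H f) := f.2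

theorem incl_one (u : H) : incl K H 1 u = Coalgebra.counit (R := K) u := rfl

theorem incl_mul (f g : FiniteDual K H) :
    incl K H (f * g) = (toConv (incl K H f) * toConv (incl K H g)).ofConv := rfl

end FiniteDual

/-- The canonical map from `M ⊗ N` to the dual of `V ⊗ W` is injective if `M → V*` and
`N → W*` are. -/
theorem dualDistrib_map_injective {M N V W : Type*} [AddCommGroup M] [Module K M] [AddCommGroup N]
    [Module K N] [AddCommGroup V] [Module K V] [AddCommGroup W] [Module K W]
    {i : M →ₗ[K] V →ₗ[K] K} {j : N →ₗ[K] W →ₗ[K] K} (hi : Function.Injective i)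
    (hj : Function.Injective j) :
    Function.Injective (TensorProduct.dualDistrib K V W ∘ₗ TensorProduct.map i j) := by
  rw [injective_iff_map_eq_zero]
  intro t ht
  let b := Module.Free.chooseBasis K N
  obtain ⟨c, rfl⟩ := TensorProduct.eq_repr_basis_right b t
  suffices c = 0 by rw [this, Finsupp.sum_zero_index]
  ext k
  apply hi
  rw [Finsupp.zero_apply, map_zero]
  ext v
  have h : ∑ k ∈ c.support, i (c k) v • b k = 0 := by
    apply hj
    rw [map_zero]
    ext w
    have := congr($ht (v ⊗ₜ w))
    simpa [Finsupp.sum, LinearMap.sum_apply] using this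
  by_cases hk : k ∈ c.support
  · exact linearIndependent_iff'.mp b.linearIndependent _ _ h k hk
  · rw [Finsupp.notMem_support_iff.mp hk, map_zero]

namespace FiniteDual

variable (K H) in
/-- The pairing of `H° ⊗ H°` with `H ⊗ H`. -/
def pairing : FiniteDual K H ⊗[K] FiniteDual K H →ₗ[K] (H ⊗[K] H →ₗ[K] K) :=
  TensorProduct.dualDistrib K H H ∘ₗ TensorProduct.map (incl K H) (incl K H)

variable (K H) in
/-- The pairing of `H° ⊗ (H° ⊗ H°)` with `H ⊗ (H ⊗ H)`. -/
def pairing₃ : FiniteDual K H ⊗[K] (FiniteDual K H ⊗[K] FiniteDual K H) →ₗ[K]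
    (H ⊗[K] (H ⊗[K] H) →ₗ[K] K) :=
  TensorProduct.dualDistrib K H (H ⊗[K] H) ∘ₗ TensorProduct.map (incl K H) (pairing K H)

theorem pairing_tmul (f g : FiniteDual K H) (u v : H) :
    pairing K H (f ⊗ₜ g) (u ⊗ₜ v) = incl K H f u * incl K H g v := by
  simp [pairing]

theorem pairing₃_tmul (f : FiniteDual K H) (t : FiniteDual K H ⊗[K] FiniteDual K H)
    (u : H) (s : H ⊗[K] H) :
    pairing₃ K H (f ⊗ₜ t) (u ⊗ₜ s) = incl K H f u * pairing K H t s := by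
  simp [pairing₃]

theorem pairing_injective : Function.Injective (pairing K H) :=
  dualDistrib_map_injective incl_injective incl_injective

theorem pairing₃_injective : Function.Injective (pairing₃ K H) :=
  dualDistrib_map_injective incl_injective pairing_injective

/-- A functional factoring through a two-sided ideal of finite codimension. -/
def ofQuotient (I : Ideal H) [I.IsTwoSided] [FiniteDimensional K (H ⧸ I)] :
    ((H ⧸ I) →ₗ[K] K) →ₗ[K] FiniteDual K H where
  toFun g := ⟨toConv (g ∘ₗ (Ideal.Quotient.mkₐ K I).toLinearMap), isRepresentative_comp _ g⟩
  map_add' _ _ := rfl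
  map_smul' _ _ := rfl

theorem exists_pairing_eq (f : FiniteDual K H) :
    ∃ t, pairing K H t = incl K H f ∘ₗ LinearMap.mul' K H := by
  obtain ⟨I, _, _, g, hg⟩ := (isRepresentative_incl f).exists_eq
  let s := (TensorProduct.dualDistribEquiv K (H ⧸ I) (H ⧸ I)).symm (g ∘ₗ LinearMap.mul' K (H ⧸ I))
  have hs : TensorProduct.dualDistrib K (H ⧸ I) (H ⧸ I) s = g ∘ₗ LinearMap.mul' K (H ⧸ I) :=
    (TensorProduct.dualDistribEquiv K (H ⧸ I) (H ⧸ I)).apply_symm_apply _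
  refine ⟨TensorProduct.map (ofQuotient I) (ofQuotient I) s, ?_⟩
  have key : ∀ s, pairing K H (TensorProduct.map (ofQuotient I) (ofQuotient I) s) =
      TensorProduct.dualDistrib K (H ⧸ I) (H ⧸ I) s ∘ₗ
        TensorProduct.map (Ideal.Quotient.mkₐ K I).toLinearMap
          (Ideal.Quotient.mkₐ K I).toLinearMap := fun s => by
    induction s using TensorProduct.induction_on with
    | zero => simp
    | add s t hs ht => simp only [map_add, hs, ht, LinearMap.add_comp]
    | tmul a b => ext u v; rw [TensorProduct.map_tmul]; simp [pairing_tmul]; rfl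
  rw [key, hs, hg]
  ext u v
  simp

variable (K H) in
/-- The comultiplication of the finite dual, transpose to the multiplication of `H`. -/
def comulLin : FiniteDual K H →ₗ[K] FiniteDual K H ⊗[K] FiniteDual K H :=
  (LinearEquiv.ofInjective (pairing K H) pairing_injective).symm.toLinearMap ∘ₗ
    LinearMap.codRestrict (LinearMap.range (pairing K H))
      ((LinearMap.lcomp K K (LinearMap.mul' K H)) ∘ₗ incl K H) exists_pairing_eq

theorem pairing_comulLin (f : FiniteDual K H) :
    pairing K H (comulLin K H f) = incl K H f ∘ₗ LinearMap.mul' K H := by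
  have := LinearEquiv.apply_symm_apply (LinearEquiv.ofInjective (pairing K H) pairing_injective)
    (LinearMap.codRestrict (LinearMap.range (pairing K H))
      ((LinearMap.lcomp K K (LinearMap.mul' K H)) ∘ₗ incl K H) exists_pairing_eq f)
  exact congr(($this).1)

theorem pairing_comulLin_tmul (f : FiniteDual K H) (u v : H) :
    pairing K H (comulLin K H f) (u ⊗ₜ v) = incl K H f (u * v) := by
  rw [pairing_comulLin]; rfl

variable (K H) in
/-- The counit of the finite dual: evaluation at `1`. -/
def counitLin : FiniteDual K H →ₗ[K] K := LinearMap.applyₗ (1 : H) ∘ₗ incl K H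

theorem counitLin_apply (f : FiniteDual K H) : counitLin K H f = incl K H f 1 := rfl

theorem incl_lid_rTensor (t : FiniteDual K H ⊗[K] FiniteDual K H) (v : H) :
    incl K H (TensorProduct.lid K _ ((counitLin K H).rTensor _ t)) v = pairing K H t (1 ⊗ₜ v) := by
  induction t using TensorProduct.induction_on with
  | zero => simp
  | add s t hs ht => simp only [map_add, LinearMap.add_apply, hs, ht]
  | tmul a b => simp [pairing_tmul, counitLin_apply]

theorem incl_rid_lTensor (t : FiniteDual K H ⊗[K] FiniteDual K H) (v : H) :
    incl K H (TensorProduct.rid K _ ((counitLin K H).lTensor _ t)) v = pairing K H t (v ⊗ₜ 1) := by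
  induction t using TensorProduct.induction_on with
  | zero => simp
  | add s t hs ht => simp only [map_add, LinearMap.add_apply, hs, ht]
  | tmul a b => simp [pairing_tmul, counitLin_apply, mul_comm]

theorem pairing₃_assoc_rTensor (t : FiniteDual K H ⊗[K] FiniteDual K H) (u v w : H) :
    pairing₃ K H (TensorProduct.assoc K _ _ _ ((comulLin K H).rTensor _ t)) (u ⊗ₜ (v ⊗ₜ w)) =
      pairing K H t ((u * v) ⊗ₜ w) := by
  have key : ∀ (s : FiniteDual K H ⊗[K] FiniteDual K H) (b : FiniteDual K H),
      pairing₃ K H (TensorProduct.assoc K _ _ _ (s ⊗ₜ b)) (u ⊗ₜ (v ⊗ₜ w)) =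
        pairing K H s (u ⊗ₜ v) * incl K H b w := fun s b => by
    induction s using TensorProduct.induction_on with
    | zero => simp
    | add s t hs ht =>
      simp only [map_add, LinearMap.add_apply, hs, ht, TensorProduct.add_tmul, add_mul]
    | tmul a b => simp [pairing_tmul, pairing₃_tmul, mul_assoc]
  induction t using TensorProduct.induction_on with
  | zero => simp
  | add s t hs ht => simp only [map_add, LinearMap.add_apply, hs, ht]
  | tmul a b => rw [LinearMap.rTensor_tmul, key, pairing_comulLin_tmul, pairing_tmul]

theorem pairing₃_lTensor (t : FiniteDual K H ⊗[K] FiniteDual K H) (u v w : H) :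
    pairing₃ K H ((comulLin K H).lTensor _ t) (u ⊗ₜ (v ⊗ₜ w)) =
      pairing K H t (u ⊗ₜ (v * w)) := by
  induction t using TensorProduct.induction_on with
  | zero => simp
  | add s t hs ht => simp only [map_add, LinearMap.add_apply, hs, ht]
  | tmul a b =>
    rw [LinearMap.lTensor_tmul, pairing₃_tmul, pairing_comulLin_tmul, pairing_tmul]

instance instCoalgebra : Coalgebra K (FiniteDual K H) where
  comul := comulLin K H
  counit := counitLin K H
  coassoc := by
    refine LinearMap.ext fun f => pairing₃_injective ?_
    ext u v w
    simp only [LinearMap.comp_apply, TensorProduct.AlgebraTensorModule.curry_apply,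
      TensorProduct.curry_apply, LinearMap.restrictScalars_self, LinearEquiv.coe_coe,
      pairing₃_assoc_rTensor, pairing₃_lTensor, pairing_comulLin_tmul, mul_assoc]
  rTensor_counit_comp_comul := by
    refine LinearMap.ext fun f => (TensorProduct.lid K _).injective (incl_injective ?_)
    ext v
    rw [LinearMap.comp_apply, incl_lid_rTensor, pairing_comulLin_tmul]
    simp
  lTensor_counit_comp_comul := by
    refine LinearMap.ext fun f => (TensorProduct.rid K _).injective (incl_injective ?_)
    ext v
    rw [LinearMap.comp_apply, incl_rid_lTensor, pairing_comulLin_tmul]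
    simp

theorem counit_apply (f : FiniteDual K H) :
    Coalgebra.counit (R := K) f = incl K H f 1 := rfl

theorem pairing_comul_tmul (f : FiniteDual K H) (u v : H) :
    pairing K H (Coalgebra.comul (R := K) f) (u ⊗ₜ v) = incl K H f (u * v) :=
  pairing_comulLin_tmul f u v

theorem pairing_comul (f : FiniteDual K H) :
    pairing K H (Coalgebra.comul (R := K) f) = incl K H f ∘ₗ LinearMap.mul' K H :=
  pairing_comulLin f

theorem pairing_one : pairing K H 1 = (1 : WithConv (H ⊗[K] H →ₗ[K] K)).ofConv := by
  ext u v
  rw [Algebra.TensorProduct.one_def]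
  simp [pairing_tmul, incl_one, LinearMap.convOne_def, mul_comm]

theorem pairing_tmul_eq (f g : FiniteDual K H) :
    pairing K H (f ⊗ₜ g) = (Algebra.TensorProduct.lmul' K (S := K)).toLinearMap ∘ₗ
      TensorProduct.map (incl K H f) (incl K H g) := by
  ext u v
  simp [pairing_tmul]

theorem pairing_mul (s t : FiniteDual K H ⊗[K] FiniteDual K H) :
    pairing K H (s * t) = (toConv (pairing K H s) * toConv (pairing K H t)).ofConv := by
  induction s using TensorProduct.induction_on with
  | zero => simp
  | add s₁ s₂ h₁ h₂ => simp only [map_add, add_mul, toConv_add, ofConv_add, h₁, h₂]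
  | tmul a b =>
    induction t using TensorProduct.induction_on with
    | zero => simp
    | add s₁ s₂ h₁ h₂ => simp only [map_add, mul_add, toConv_add, ofConv_add, h₁, h₂]
    | tmul c d =>
      have h1 := TensorProduct.map_convMul_map (f := toConv (incl K H a)) (g := toConv (incl K H b))
        (h := toConv (incl K H c)) (k := toConv (incl K H d))
      have h2 := LinearMap.algHom_comp_convMul_distrib (Algebra.TensorProduct.lmul' K (S := K))
        (toConv (TensorProduct.map (incl K H a) (incl K H b)))
        (toConv (TensorProduct.map (incl K H c) (incl K H d)))
      rw [Algebra.TensorProduct.tmul_mul_tmul, pairing_tmul_eq, pairing_tmul_eq, pairing_tmul_eq,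
        incl_mul, incl_mul]
      refine Eq.trans ?_ h2
      exact congr(_ ∘ₗ ($h1).ofConv).symm

instance instBialgebra : Bialgebra K (FiniteDual K H) :=
  Bialgebra.mk' K (FiniteDual K H)
    (by rw [counit_apply, incl_one, Bialgebra.counit_one])
    (fun {f g} => by
      simp [counit_apply, incl_mul, Algebra.TensorProduct.one_def])
    (by
      refine pairing_injective ?_
      rw [pairing_comul, pairing_one]
      ext u v
      simp [incl_one, mul_comm])
    (fun {f g} => by
      refine pairing_injective ?_
      rw [pairing_mul, pairing_comul, pairing_comul, pairing_comul, incl_mul]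
      exact LinearMap.convMul_comp_coalgHom_distrib _ _ (Bialgebra.mulCoalgHom K H))

/-- The transpose of an anti-endomorphism `S` of `H`, as a linear map `H° → H°`. -/
def antipodeLin (S : H →ₐ[K] Hᵐᵒᵖ) : FiniteDual K H →ₗ[K] FiniteDual K H where
  toFun f := ⟨toConv (incl K H f ∘ₗ
    ((MulOpposite.opLinearEquiv K).symm.toLinearMap ∘ₗ S.toLinearMap)),
    isRepresentative_antipode S (isRepresentative_incl f)⟩
  map_add' _ _ := rfl
  map_smul' _ _ := rfl

theorem incl_antipodeLin (S : H →ₐ[K] Hᵐᵒᵖ) (f : FiniteDual K H) :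
    incl K H (antipodeLin S f) = incl K H f ∘ₗ
      ((MulOpposite.opLinearEquiv K).symm.toLinearMap ∘ₗ S.toLinearMap) := rfl

theorem incl_mul'_rTensor (S : H →ₐ[K] Hᵐᵒᵖ) (t : FiniteDual K H ⊗[K] FiniteDual K H) (u : H) :
    incl K H (LinearMap.mul' K _ ((antipodeLin S).rTensor _ t)) u =
      pairing K H t (((MulOpposite.opLinearEquiv K).symm.toLinearMap ∘ₗ
        S.toLinearMap).rTensor H (Coalgebra.comul (R := K) u)) := by
  induction t using TensorProduct.induction_on with
  | zero => simp
  | add s t hs ht => simp only [map_add, LinearMap.add_apply, hs, ht]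
  | tmul a b =>
    rw [LinearMap.rTensor_tmul, LinearMap.mul'_apply, incl_mul, pairing_tmul_eq, incl_antipodeLin,
      LinearMap.comp_apply, LinearMap.rTensor, ← LinearMap.comp_apply (TensorProduct.map _ _),
      ← TensorProduct.map_comp]
    rfl

theorem incl_mul'_lTensor (S : H →ₐ[K] Hᵐᵒᵖ) (t : FiniteDual K H ⊗[K] FiniteDual K H) (u : H) :
    incl K H (LinearMap.mul' K _ ((antipodeLin S).lTensor _ t)) u =
      pairing K H t (((MulOpposite.opLinearEquiv K).symm.toLinearMap ∘ₗ
        S.toLinearMap).lTensor H (Coalgebra.comul (R := K) u)) := by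
  induction t using TensorProduct.induction_on with
  | zero => simp
  | add s t hs ht => simp only [map_add, LinearMap.add_apply, hs, ht]
  | tmul a b =>
    rw [LinearMap.lTensor_tmul, LinearMap.mul'_apply, incl_mul, pairing_tmul_eq, incl_antipodeLin,
      LinearMap.comp_apply, LinearMap.lTensor, ← LinearMap.comp_apply (TensorProduct.map _ _),
      ← TensorProduct.map_comp]
    rfl

variable (K) in
theorem incl_algebraMap (c : K) (u : H) :
    incl K H (algebraMap K _ c) u = c * Coalgebra.counit (R := K) u := by
  rw [Algebra.algebraMap_eq_smul_one, map_smul, LinearMap.smul_apply, incl_one, smul_eq_mul]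

/-- The Hopf algebra structure of the finite dual of the universal enveloping algebra. -/
instance instHopfAlgebra (L : Type*) [LieRing L] [LieAlgebra K L] :
    HopfAlgebra K (FiniteDual K (UniversalEnvelopingAlgebra K L)) where
  antipode := antipodeLin (UniversalEnvelopingAlgebra.antipodeHom K L)
  mul_antipode_rTensor_comul := by
    refine LinearMap.ext fun f => incl_injective (LinearMap.ext fun u => ?_)
    have h := UniversalEnvelopingAlgebra.mul'_rTensor_antipodeLin K u
    rw [LinearMap.comp_apply, LinearMap.comp_apply, incl_mul'_rTensor, pairing_comul,
      LinearMap.comp_apply]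
    refine (congrArg (incl K _ f) h).trans ?_
    rw [LinearMap.comp_apply, Algebra.linearMap_apply, incl_algebraMap, counit_apply,
      Algebra.algebraMap_eq_smul_one, map_smul, smul_eq_mul, mul_comm]
  mul_antipode_lTensor_comul := by
    refine LinearMap.ext fun f => incl_injective (LinearMap.ext fun u => ?_)
    have h := UniversalEnvelopingAlgebra.mul'_lTensor_antipodeLin K u
    rw [LinearMap.comp_apply, LinearMap.comp_apply, incl_mul'_lTensor, pairing_comul,
      LinearMap.comp_apply]
    refine (congrArg (incl K _ f) h).trans ?_
    rw [LinearMap.comp_apply, Algebra.linearMap_apply, incl_algebraMap, counit_apply,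
      Algebra.algebraMap_eq_smul_one, map_smul, smul_eq_mul, mul_comm]

end FiniteDual

end

/-! Group schemes over a field and the affine envelope. -/

noncomputable section

open CategoryTheory AlgebraicGeometry Limits

/-- Group schemes over a field `K`: group objects in the category of schemes over `Spec K`. -/
abbrev GroupSchemeOver (K : Type u) [Field K] := Grp (Over (Spec (.of K)))

namespace GroupSchemeOver

variable {K : Type u} [Field K]

/-- The underlying scheme of a group scheme. -/
abbrev toScheme (G : GroupSchemeOver K) : Scheme.{u} := G.X.left

/-- The morphism of schemes underlying a morphism of group schemes. -/
abbrev schemeHom {G H : GroupSchemeOver K} (f : G ⟶ H) : G.toScheme ⟶ H.toScheme :=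
  f.hom.hom.left

/-- An algebraic group scheme over `K`: affine and of finite type over `K`. -/
structure IsAlgebraic (G : GroupSchemeOver K) : Prop where
  affine : IsAffine G.toScheme
  finiteType : LocallyOfFiniteType G.X.hom

/-- A morphism `G ⟶ H` of affine group schemes over a field is a quotient morphism if the map of
coordinate rings `𝒪(H) → 𝒪(G)` is injective. For affine group schemes over a field this is
equivalent to being faithfully flat, and every faithfully flat morphism satisfies it trivially. -/
def IsQuotientMap {G H : GroupSchemeOver K} (f : G ⟶ H) : Prop :=
  Function.Injective (schemeHom f).appTop.hom

/-- A group scheme is pro-connected if it is the limit of a projective system, indexed by a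
nonempty directed set, of connected algebraic group schemes with quotient morphisms as
transition morphisms. -/
def IsProConnected (G : GroupSchemeOver K) : Prop :=
  ∃ (J : Type u) (_ : Preorder J) (_ : IsDirectedOrder J) (_ : Nonempty J)
    (F : Jᵒᵖ ⥤ GroupSchemeOver K) (π : (Functor.const Jᵒᵖ).obj G ⟶ F),
    Nonempty (IsLimit (Cone.mk G π)) ∧
    (∀ j, (F.obj j).IsAlgebraic ∧ ConnectedSpace (F.obj j).toScheme) ∧
    ∀ (i j : Jᵒᵖ) (φ : i ⟶ j), IsQuotientMap (F.map φ)

end GroupSchemeOver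

/-- The affine envelope `𝐆(L) = Spec (U(L)°)` of a Lie algebra `L`, with the group structure given
by the Hopf algebra structure of `U(L)°`. -/
def affineEnvelope (K : Type u) [Field K] (L : Type u) [LieRing L] [LieAlgebra K L] :
    GroupSchemeOver K :=
  (hopfSpec (.of K)).obj (.op (.of K (FiniteDual K (UniversalEnvelopingAlgebra K L))))

end

/-! Both statements reduce to two facts about the commutative Hopf algebra `A = U(L)°`: its only
idempotents are `0` and `1`, and every element lies in a finitely generated Hopf subalgebra.

Idempotents (`eq_zero_or_one_of_convMul_self`): since `x` in `L` is primitive, the transpose of left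
multiplication by `x` is a derivation of the convolution algebra `U(L)*`, which is commutative
because `U(L)` is cocommutative. A derivation of a commutative ring kills every idempotent `e`, so
`e` vanishes on `L · U(L)` and is a multiple of the counit, the unit of the convolution product. The
scalar is an idempotent of the field `K`.

Local finiteness (`exists_isHopf_fg_mem`): a representative functional vanishes on an ideal of
finite codimension, which can be shrunk to one stable under the antipode. The functionals that
vanish on the smaller ideal form a finite-dimensional subcoalgebra stable under the antipode, and
they generate a Hopf subalgebra.

A ring that embeds in `A` again has only trivial idempotents, so its spectrum is connected. This
gives (1) for coordinate rings of quotients. For (2), `A` is the directed union of its finitely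
generated Hopf subalgebras, and `Spec` turns this colimit into a limit of connected algebraic groups
whose transition maps are dual to inclusions. -/

/-! Hopf subalgebras of commutative Hopf algebras over a field. -/

noncomputable section

open TensorProduct

namespace Subalgebra

variable {K : Type*} [Field K] {A : Type*} [CommRing A] [HopfAlgebra K A]

/-- A subalgebra of a commutative Hopf algebra is a Hopf subalgebra if it is stable under the
comultiplication and the antipode. -/
structure IsHopf (S : Subalgebra K A) : Prop where
  comul_mem : ∀ a ∈ S, Coalgebra.comul (R := K) a ∈ (Algebra.TensorProduct.map S.val S.val).range
  antipode_mem : ∀ a ∈ S, HopfAlgebra.antipode K a ∈ S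

/-- Everything is flat over a field. Hence `S ⊗ S` may be treated as a subspace of `A ⊗ A`, and
identities in `S` can be checked in `A`. -/
theorem tensorProduct_map_val_injective (S : Subalgebra K A) :
    Function.Injective (Algebra.TensorProduct.map S.val S.val) :=
  TensorProduct.map_injective_of_flat_flat S.val.toLinearMap S.val.toLinearMap
    Subtype.val_injective Subtype.val_injective

theorem tensorProduct_map_val_range_mono {S T : Subalgebra K A} (h : S ≤ T) :
    (Algebra.TensorProduct.map S.val S.val).range ≤ (Algebra.TensorProduct.map T.val T.val).range := by
  have : Algebra.TensorProduct.map S.val S.val = (Algebra.TensorProduct.map T.val T.val).comp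
      (Algebra.TensorProduct.map (inclusion h) (inclusion h)) := by
    ext <;> simp
  rw [this]
  exact AlgHom.range_comp_le_range _ _

/-- Comultiplication and, as `A` is commutative, the antipode are algebra maps, so preimages of
subalgebras are subalgebras and it suffices to look at `S` and `T`. This makes the finitely
generated Hopf subalgebras a directed family. -/
theorem IsHopf.sup {S T : Subalgebra K A} (hS : S.IsHopf) (hT : T.IsHopf) : (S ⊔ T).IsHopf where
  comul_mem := by
    have h : S ⊔ T ≤ ((Algebra.TensorProduct.map (S ⊔ T).val (S ⊔ T).val).range).comap
        (Bialgebra.comulAlgHom K A) :=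
      sup_le (fun a ha => tensorProduct_map_val_range_mono le_sup_left (hS.comul_mem a ha))
        (fun a ha => tensorProduct_map_val_range_mono le_sup_right (hT.comul_mem a ha))
    exact h
  antipode_mem := by
    have h : S ⊔ T ≤ (S ⊔ T).comap (HopfAlgebra.antipodeAlgHom K A) :=
      sup_le (fun a ha => le_sup_left (a := S) (hS.antipode_mem a ha))
        (fun a ha => le_sup_right (a := S) (hT.antipode_mem a ha))
    exact h

/-- The subalgebra generated by a subcoalgebra that is stable under the antipode is a Hopf
subalgebra. -/
theorem isHopf_adjoin {V : Submodule K A}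
    (hc : ∀ a ∈ V, Coalgebra.comul (R := K) a ∈
      LinearMap.range (TensorProduct.map V.subtype V.subtype))
    (hs : ∀ a ∈ V, HopfAlgebra.antipode K a ∈ V) : (Algebra.adjoin K (V : Set A)).IsHopf where
  comul_mem := by
    have h : Algebra.adjoin K (V : Set A) ≤
        ((Algebra.TensorProduct.map (Algebra.adjoin K (V : Set A)).val
          (Algebra.adjoin K (V : Set A)).val).range).comap (Bialgebra.comulAlgHom K A) := by
      rw [Algebra.adjoin_le_iff]
      intro a ha
      obtain ⟨t, ht⟩ := hc a ha
      -- A tensor witnessing `Δ a ∈ V ⊗ V` is pushed forward along the inclusion of `V` in the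
      -- algebra it generates.
      have hV : V ≤ Subalgebra.toSubmodule (Algebra.adjoin K (V : Set A)) := Algebra.subset_adjoin
      refine ⟨TensorProduct.map (Submodule.inclusion hV) (Submodule.inclusion hV) t, ?_⟩
      refine Eq.trans ?_ ht
      change TensorProduct.map _ _ (TensorProduct.map _ _ t) = _
      rw [← LinearMap.comp_apply, ← TensorProduct.map_comp]
      rfl
    exact h
  antipode_mem := by
    have h : Algebra.adjoin K (V : Set A) ≤
        (Algebra.adjoin K (V : Set A)).comap (HopfAlgebra.antipodeAlgHom K A) :=
      Algebra.adjoin_le fun a ha => Algebra.subset_adjoin (hs a ha)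
    exact h

namespace IsHopf

variable {S T : Subalgebra K A} (hS : S.IsHopf)

/-- The comultiplication of a Hopf subalgebra. -/
def comulHom : S →ₐ[K] S ⊗[K] S :=
  (AlgEquiv.ofInjective _ (tensorProduct_map_val_injective S)).symm.toAlgHom.comp
    (((Bialgebra.comulAlgHom K A).comp S.val).codRestrict _ fun a => hS.comul_mem a a.2)

theorem map_comp_comulHom : (Algebra.TensorProduct.map S.val S.val).comp hS.comulHom =
    (Bialgebra.comulAlgHom K A).comp S.val := by
  ext a
  have := (AlgEquiv.ofInjective _ (tensorProduct_map_val_injective S)).apply_symm_apply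
    ((((Bialgebra.comulAlgHom K A).comp S.val).codRestrict _ fun a => hS.comul_mem a a.2) a)
  exact congr(($this).1)

theorem map_comulHom (a : S) : Algebra.TensorProduct.map S.val S.val (hS.comulHom a) =
    Coalgebra.comul (R := K) (a : A) :=
  congr($(hS.map_comp_comulHom) a)

/-- With `map_val_map_comulHom`, this carries the two sides of coassociativity from `S` to `A`. -/
theorem map_val_assoc_map_comulHom (t : S ⊗[K] S) :
    Algebra.TensorProduct.map S.val (Algebra.TensorProduct.map S.val S.val)
      (Algebra.TensorProduct.assoc K K K S S S
        (Algebra.TensorProduct.map hS.comulHom (.id K S) t)) =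
      Algebra.TensorProduct.assoc K K K A A A
        (Algebra.TensorProduct.map (Bialgebra.comulAlgHom K A) (.id K A)
          (Algebra.TensorProduct.map S.val S.val t)) := by
  have key : ∀ (s : S ⊗[K] S) (b : S),
      Algebra.TensorProduct.map S.val (Algebra.TensorProduct.map S.val S.val)
        (Algebra.TensorProduct.assoc K K K S S S (s ⊗ₜ b)) =
        Algebra.TensorProduct.assoc K K K A A A
          (Algebra.TensorProduct.map S.val S.val s ⊗ₜ (b : A)) := fun s b => by
    induction s using TensorProduct.induction_on with
    | zero => simp
    | add s t hs ht => simp only [map_add, TensorProduct.add_tmul, hs, ht]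
    | tmul a c => simp
  induction t using TensorProduct.induction_on with
  | zero => simp
  | add s t hs ht => simp only [map_add, hs, ht]
  | tmul a b =>
    rw [Algebra.TensorProduct.map_tmul, key, map_comulHom]
    simp

theorem map_val_map_comulHom (t : S ⊗[K] S) :
    Algebra.TensorProduct.map S.val (Algebra.TensorProduct.map S.val S.val)
        (Algebra.TensorProduct.map (.id K S) hS.comulHom t) =
      Algebra.TensorProduct.map (.id K A) (Bialgebra.comulAlgHom K A)
          (Algebra.TensorProduct.map S.val S.val t) := by
  induction t using TensorProduct.induction_on with
  | zero => simp
  | add s t hs ht => simp only [map_add, hs, ht]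
  | tmul a b => simp [map_comulHom]

/-- The bialgebra structure of a Hopf subalgebra. -/
abbrev bialgebra : Bialgebra K S :=
  Bialgebra.ofAlgHom hS.comulHom ((Bialgebra.counitAlgHom K A).comp S.val)
    (by
      -- Each coalgebra axiom is tested after an injection into tensor powers of `A`, where it
      -- becomes the axiom for `A`.
      have hinj : Function.Injective (Algebra.TensorProduct.map S.val
          (Algebra.TensorProduct.map S.val S.val)) :=
        TensorProduct.map_injective_of_flat_flat S.val.toLinearMap
          (Algebra.TensorProduct.map S.val S.val).toLinearMap
          Subtype.val_injective S.tensorProduct_map_val_injective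
      refine AlgHom.ext fun a => hinj ?_
      refine (hS.map_val_assoc_map_comulHom _).trans ?_
      refine .trans ?_ (hS.map_val_map_comulHom _).symm
      refine (congrArg _ (congrArg _ (hS.map_comulHom a))).trans ?_
      refine .trans ?_ (congrArg _ (hS.map_comulHom a)).symm
      exact Coalgebra.coassoc_apply (R := K) (a : A))
    (by
      have key : ∀ t : S ⊗[K] S, Algebra.TensorProduct.map (AlgHom.id K K) S.val
          (Algebra.TensorProduct.map ((Bialgebra.counitAlgHom K A).comp S.val) (.id K S) t) =
          Algebra.TensorProduct.map (Bialgebra.counitAlgHom K A) (.id K A)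
            (Algebra.TensorProduct.map S.val S.val t) := fun t => by
        induction t using TensorProduct.induction_on with
        | zero => simp
        | add s t hs ht => simp only [map_add, hs, ht]
        | tmul a b => simp
      have hinj : Function.Injective (Algebra.TensorProduct.map (AlgHom.id K K) S.val) :=
        TensorProduct.map_injective_of_flat_flat LinearMap.id S.val.toLinearMap
          Function.injective_id Subtype.val_injective
      refine AlgHom.ext fun a => hinj ?_
      refine (key _).trans ?_
      refine (congrArg _ (hS.map_comulHom a)).trans ?_
      exact Coalgebra.rTensor_counit_comul (R := K) (a : A))
    (by
      have key : ∀ t : S ⊗[K] S, Algebra.TensorProduct.map S.val (AlgHom.id K K)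
          (Algebra.TensorProduct.map (.id K S) ((Bialgebra.counitAlgHom K A).comp S.val) t) =
          Algebra.TensorProduct.map (.id K A) (Bialgebra.counitAlgHom K A)
            (Algebra.TensorProduct.map S.val S.val t) := fun t => by
        induction t using TensorProduct.induction_on with
        | zero => simp
        | add s t hs ht => simp only [map_add, hs, ht]
        | tmul a b => simp
      have hinj : Function.Injective (Algebra.TensorProduct.map S.val (AlgHom.id K K)) :=
        TensorProduct.map_injective_of_flat_flat S.val.toLinearMap LinearMap.id
          Subtype.val_injective Function.injective_id
      refine AlgHom.ext fun a => hinj ?_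
      refine (key _).trans ?_
      refine (congrArg _ (hS.map_comulHom a)).trans ?_
      exact Coalgebra.lTensor_counit_comul (R := K) (a : A))

/-- The antipode of a Hopf subalgebra. -/
def antipodeHom : S →ₐ[K] S :=
  ((HopfAlgebra.antipodeAlgHom K A).comp S.val).codRestrict S fun a => hS.antipode_mem a a.2

theorem coe_antipodeHom (a : S) : (hS.antipodeHom a : A) = HopfAlgebra.antipode K (a : A) := rfl

/-- The Hopf algebra structure of a Hopf subalgebra. -/
abbrev hopfAlgebra : HopfAlgebra K S :=
  letI := hS.bialgebra
  .ofAlgHom hS.antipodeHom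
    (by
      -- Seen inside `A`, the convolution of the restricted antipode with the identity is the one
      -- formed in `A`.
      have key : ∀ t : S ⊗[K] S,
          (Algebra.TensorProduct.lift hS.antipodeHom (.id K S) fun _ _ => Commute.all _ _) t =
          LinearMap.mul' K A ((HopfAlgebra.antipode K).rTensor A
            (Algebra.TensorProduct.map S.val S.val t)) := fun t => by
        induction t using TensorProduct.induction_on with
        | zero => simp
        | add s t hs ht => simp only [map_add, AddMemClass.coe_add, hs, ht]
        | tmul a b => simp [coe_antipodeHom]
      refine AlgHom.ext fun a => Subtype.ext ?_
      refine (key (hS.comulHom a)).trans ?_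
      rw [map_comulHom]
      exact HopfAlgebra.mul_antipode_rTensor_comul_apply (R := K) (a : A))
    (by
      have key : ∀ t : S ⊗[K] S,
          (Algebra.TensorProduct.lift (.id K S) hS.antipodeHom fun _ _ => Commute.all _ _) t =
          LinearMap.mul' K A ((HopfAlgebra.antipode K).lTensor A
            (Algebra.TensorProduct.map S.val S.val t)) := fun t => by
        induction t using TensorProduct.induction_on with
        | zero => simp
        | add s t hs ht => simp only [map_add, AddMemClass.coe_add, hs, ht]
        | tmul a b => simp [coe_antipodeHom]
      refine AlgHom.ext fun a => Subtype.ext ?_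
      refine (key (hS.comulHom a)).trans ?_
      rw [map_comulHom]
      exact HopfAlgebra.mul_antipode_lTensor_comul_apply (R := K) (a : A))

/-- A Hopf subalgebra as an object of the category of commutative Hopf algebras. -/
def toCommHopfAlgCat {K : Type u} [Field K] {A : Type u} [CommRing A] [HopfAlgebra K A]
    {S : Subalgebra K A} (hS : S.IsHopf) : CommHopfAlgCat.{u} K :=
  letI := hS.hopfAlgebra
  .of K S

/-- The inclusion of a Hopf subalgebra. -/
def subtypeHom {K : Type u} [Field K] {A : Type u} [CommRing A] [HopfAlgebra K A]
    {S : Subalgebra K A} (hS : S.IsHopf) : hS.toCommHopfAlgCat ⟶ CommHopfAlgCat.of K A :=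
  letI := hS.hopfAlgebra
  CommHopfAlgCat.ofHom (.ofAlgHom S.val rfl hS.map_comp_comulHom)

/-- The inclusion between Hopf subalgebras. -/
def inclusionHom {K : Type u} [Field K] {A : Type u} [CommRing A] [HopfAlgebra K A]
    {S T : Subalgebra K A} (hS : S.IsHopf) (hT : T.IsHopf) (h : S ≤ T) :
    hS.toCommHopfAlgCat ⟶ hT.toCommHopfAlgCat :=
  letI := hS.hopfAlgebra
  letI := hT.hopfAlgebra
  CommHopfAlgCat.ofHom (.ofAlgHom (inclusion h) rfl (by
    refine AlgHom.ext fun a => T.tensorProduct_map_val_injective ?_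
    refine .trans ?_ (hT.map_comulHom (inclusion h a)).symm
    refine .trans ?_ (hS.map_comulHom a)
    have key : (Algebra.TensorProduct.map T.val T.val).comp
        (Algebra.TensorProduct.map (inclusion h) (inclusion h)) =
        Algebra.TensorProduct.map S.val S.val := by
      ext <;> simp
    exact congr($key (hS.comulHom a))))

end IsHopf
end Subalgebra

end

/-! Idempotents and Hopf subalgebras of the finite dual of an enveloping algebra. -/

noncomputable section

open TensorProduct WithConv

namespace UniversalEnvelopingAlgebra

variable (K : Type*) [Field K] (L : Type*) [LieRing L] [LieAlgebra K L]

-- The antipode reverses products and negates the generators. Being an involution, it exchanges the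
-- two conditions that cut out the ideal in `exists_isHopf_fg_mem`.
variable {L} in
theorem antipodeLin_antipodeLin (u : UniversalEnvelopingAlgebra K L) :
    antipodeLin K L (antipodeLin K L u) = u := by
  induction u using induction_left K with
  | one => simp only [antipodeLin_one]
  | add u v hu hv => simp only [map_add, hu, hv]
  | smul c u hu => simp only [map_smul, hu]
  | mul x u hu => simp only [antipodeLin_mul, antipodeLin_ι, map_neg, neg_neg, hu]

/-- The transpose of left multiplication by an element of the Lie algebra is a derivation of the
convolution algebra. -/
theorem convMul_ι_mul (f g : WithConv (UniversalEnvelopingAlgebra K L →ₗ[K] K)) (x : L)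
    (u : UniversalEnvelopingAlgebra K L) :
    (f * g).ofConv (ι K x * u) =
      (toConv (f.ofConv ∘ₗ LinearMap.mulLeft K (ι K x)) * g).ofConv u +
        (f * toConv (g.ofConv ∘ₗ LinearMap.mulLeft K (ι K x))).ofConv u := by
  simp only [LinearMap.convMul_def, LinearMap.comp_apply, Bialgebra.comul_mul, comul_ι,
    ofConv_toConv]
  generalize Coalgebra.comul (R := K) u = t
  induction t using TensorProduct.induction_on with
  | zero => simp
  | add s t hs ht => simp only [mul_add, map_add, hs, ht]; abel
  | tmul a b => simp [-ι_apply, add_mul]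

/-- An idempotent of the convolution algebra of functionals on an enveloping algebra is trivial. -/
theorem eq_zero_or_one_of_convMul_self {e : WithConv (UniversalEnvelopingAlgebra K L →ₗ[K] K)}
    (he : e * e = e) : e = 0 ∨ e = 1 := by
  have hD : ∀ (x : L) (u : UniversalEnvelopingAlgebra K L), e.ofConv (ι K x * u) = 0 := by
    intro x
    set d : WithConv (UniversalEnvelopingAlgebra K L →ₗ[K] K) :=
      toConv (e.ofConv ∘ₗ LinearMap.mulLeft K (ι K x)) with hd
    -- The Leibniz rule applied to `e * e = e`.
    have h1 : d = d * e + e * d := by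
      apply ofConv_injective
      ext u
      have := convMul_ι_mul K L e e x u
      rw [he] at this
      exact this
    have hc : d * e = e * d := mul_comm d e
    -- Multiplying `d = d * e + e * d` by `e` gives `e * d = e * d + e * d`.
    have h2 : e * d = 0 := by
      have h3 : e * d = e * d + e * d := by
        conv_lhs => rw [h1, hc, mul_add, ← mul_assoc, he]
      exact left_eq_add.mp h3
    have h4 : d = 0 := by rw [h1, hc, h2, add_zero]
    intro u
    exact congr(($h4).ofConv u)
  -- `U(L)` is spanned by `1` and the products `x * u` with `x` in `L`, and `e` and the counit both
  -- vanish on the latter.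
  have h1 : e = e.ofConv 1 • 1 := by
    apply ofConv_injective
    ext u
    induction u using induction_left K with
    | one => simp [LinearMap.convOne_def]
    | add u v hu hv => rw [map_add, map_add, hu, hv]
    | smul c u hu => rw [map_smul, map_smul, hu]
    | mul x u hu => simp [-ι_apply, hD, LinearMap.convOne_def, counit_ι]
  -- Since `Δ 1 = 1 ⊗ 1`, evaluation at `1` is multiplicative for convolution.
  have h2 : IsIdempotentElem (e.ofConv 1) := by
    have := congr(($he).ofConv 1)
    rwa [LinearMap.convMul_def, LinearMap.comp_apply, LinearMap.comp_apply, Bialgebra.comul_one,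
      Algebra.TensorProduct.one_def, TensorProduct.map_tmul, LinearMap.mul'_apply] at this
  rcases IsIdempotentElem.iff_eq_zero_or_one.mp h2 with h | h
  · left; rw [h1, h, zero_smul]
  · right; rw [h1, h, one_smul]

end UniversalEnvelopingAlgebra

/-! ### Idempotents and local finiteness of the finite dual -/

namespace FiniteDual

section

variable {K : Type*} [Field K] {H : Type*} [Ring H] [Bialgebra K H] [Coalgebra.IsCocomm K H]

/-- Identifies the dual of `H ⧸ I` with the annihilator of `I` in `H°`. -/
theorem range_ofQuotient (I : Ideal H) [I.IsTwoSided] [FiniteDimensional K (H ⧸ I)]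
    (f : FiniteDual K H) :
    f ∈ LinearMap.range (ofQuotient (K := K) I) ↔ ∀ x ∈ I, incl K H f x = 0 := by
  constructor
  · rintro ⟨g, rfl⟩ x hx
    change g (Ideal.Quotient.mk I x) = 0
    rw [Ideal.Quotient.eq_zero_iff_mem.mpr hx, map_zero]
  · intro h
    exact ⟨(I.restrictScalars K).liftQ (incl K H f) fun x hx => h x hx, incl_injective rfl⟩

/-- The functionals that vanish on a two-sided ideal of finite codimension form a subcoalgebra. -/
theorem comul_mem_range_ofQuotient (I : Ideal H) [I.IsTwoSided] [FiniteDimensional K (H ⧸ I)]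
    (f : FiniteDual K H) (hf : f ∈ LinearMap.range (ofQuotient (K := K) I)) :
    Coalgebra.comul (R := K) f ∈ LinearMap.range (TensorProduct.map
      (LinearMap.range (ofQuotient (K := K) I)).subtype
      (LinearMap.range (ofQuotient (K := K) I)).subtype) := by
  obtain ⟨g, rfl⟩ := hf
  -- In finite dimension `(Q ⊗ Q)* = Q* ⊗ Q*`. Here `s` is the transpose of multiplication on `Q = H
  -- ⧸ I`, applied to `g`.
  let s := (TensorProduct.dualDistribEquiv K (H ⧸ I) (H ⧸ I)).symm (g ∘ₗ LinearMap.mul' K (H ⧸ I))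
  have hs : TensorProduct.dualDistrib K (H ⧸ I) (H ⧸ I) s = g ∘ₗ LinearMap.mul' K (H ⧸ I) :=
    (TensorProduct.dualDistribEquiv K (H ⧸ I) (H ⧸ I)).apply_symm_apply _
  refine ⟨TensorProduct.map (ofQuotient I).rangeRestrict (ofQuotient I).rangeRestrict s, ?_⟩
  rw [← LinearMap.comp_apply, ← TensorProduct.map_comp]
  change TensorProduct.map (ofQuotient I) (ofQuotient I) s = _
  have key : ∀ s, pairing K H (TensorProduct.map (ofQuotient I) (ofQuotient I) s) =
      TensorProduct.dualDistrib K (H ⧸ I) (H ⧸ I) s ∘ₗ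
        TensorProduct.map (Ideal.Quotient.mkₐ K I).toLinearMap
          (Ideal.Quotient.mkₐ K I).toLinearMap := fun s => by
    induction s using TensorProduct.induction_on with
    | zero => simp
    | add s t hs ht => simp only [map_add, hs, ht, LinearMap.add_comp]
    | tmul a b => ext u v; rw [TensorProduct.map_tmul]; simp [pairing_tmul]; rfl
  apply pairing_injective
  rw [key, hs, pairing_comul]
  ext u v
  simp
  rfl

end

variable (K : Type*) [Field K] (L : Type*) [LieRing L] [LieAlgebra K L]

theorem eq_zero_or_one_of_isIdempotentElem
    {e : FiniteDual K (UniversalEnvelopingAlgebra K L)} (he : IsIdempotentElem e) :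
    e = 0 ∨ e = 1 :=
  (UniversalEnvelopingAlgebra.eq_zero_or_one_of_convMul_self K L
    (e := e.1) congr(($he).1)).imp (fun h => Subtype.ext h) (fun h => Subtype.ext h)

instance : Nontrivial (FiniteDual K (UniversalEnvelopingAlgebra K L)) :=
  ⟨0, 1, fun h => zero_ne_one (α := K) <| by
    have := congr(incl K _ $h 1)
    rwa [incl_one, Bialgebra.counit_one, map_zero] at this⟩

/-- Every element of the finite dual of an enveloping algebra lies in a finitely generated Hopf
subalgebra. -/
theorem exists_isHopf_fg_mem (f : FiniteDual K (UniversalEnvelopingAlgebra K L)) :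
    ∃ S : Subalgebra K (FiniteDual K (UniversalEnvelopingAlgebra K L)),
      S.IsHopf ∧ S.FG ∧ f ∈ S := by
  obtain ⟨I, hI, hfin, hf⟩ := isRepresentative_incl f
  -- The kernel is `I ∩ S⁻¹(I)`, with `S` the antipode. It has finite codimension because the target
  -- of `φ` is finite-dimensional, and it is `S`-stable because `S` is an involution.
  let φ := (Ideal.Quotient.mkₐ K I).prod ((AlgHom.op (Ideal.Quotient.mkₐ K I)).comp
    (UniversalEnvelopingAlgebra.antipodeHom K L))
  have := hfin
  have hφ : FiniteDimensional K (UniversalEnvelopingAlgebra K L ⧸ RingHom.ker φ) :=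
    FiniteDimensional.of_injective (Ideal.kerLiftAlg φ).toLinearMap (Ideal.kerLiftAlg_injective φ)
  have hmem : ∀ u, u ∈ RingHom.ker φ ↔
      u ∈ I ∧ UniversalEnvelopingAlgebra.antipodeLin K L u ∈ I := fun u => by
    rw [RingHom.mem_ker, Prod.ext_iff]
    refine and_congr Ideal.Quotient.eq_zero_iff_mem ?_
    rw [← Ideal.Quotient.eq_zero_iff_mem]
    exact MulOpposite.op_eq_zero_iff _
  let V := LinearMap.range (ofQuotient (K := K) (RingHom.ker φ))
  refine ⟨Algebra.adjoin K V, Subalgebra.isHopf_adjoin (comul_mem_range_ofQuotient _) ?_, ?_, ?_⟩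
  · intro g hg
    rw [range_ofQuotient] at hg ⊢
    intro u hu
    refine hg (UniversalEnvelopingAlgebra.antipodeLin K L u) ?_
    rw [hmem] at hu ⊢
    rw [UniversalEnvelopingAlgebra.antipodeLin_antipodeLin]
    exact hu.symm
  · have : FiniteDimensional K V := inferInstance
    obtain ⟨s, hs⟩ := (Submodule.fg_iff_finiteDimensional V).mpr this
    exact ⟨s, by rw [← hs, Algebra.adjoin_span]⟩
  · refine Algebra.subset_adjoin ((range_ofQuotient _ f).mpr fun x hx => hf x ((hmem x).mp hx).1)

end FiniteDual

end

/-! Connectedness and projective limits of affine group schemes. -/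

noncomputable section

open CategoryTheory AlgebraicGeometry Limits

/-- Clopen subsets of a prime spectrum are the basic opens of idempotents. -/
theorem PrimeSpectrum.connectedSpace_of_isIdempotentElem {R : Type*} [CommRing R] [Nontrivial R]
    (h : ∀ e : R, IsIdempotentElem e → e = 0 ∨ e = 1) : ConnectedSpace (PrimeSpectrum R) where
  toPreconnectedSpace := by
    rw [preconnectedSpace_iff_clopen]
    intro s hs
    obtain ⟨e, he, rfl⟩ := PrimeSpectrum.isClopen_iff.mp hs
    rcases h e he with rfl | rfl
    · left; simp
    · right; simp
  toNonempty := inferInstance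

/-- An injective ring map reflects triviality of idempotents. This serves both for quotients of the
envelope and for its Hopf subalgebras. -/
theorem PrimeSpectrum.connectedSpace_of_injective {R A : Type*} [CommRing R] [CommRing A]
    [Nontrivial A] (h : ∀ e : A, IsIdempotentElem e → e = 0 ∨ e = 1) (f : R →+* A)
    (hf : Function.Injective f) : ConnectedSpace (PrimeSpectrum R) := by
  have : Nontrivial R := f.domain_nontrivial
  refine connectedSpace_of_isIdempotentElem fun e he => ?_
  rcases h _ (he.map f) with h0 | h1
  · exact .inl (hf (h0.trans (map_zero f).symm))
  · exact .inr (hf (h1.trans (map_one f).symm))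

/-! ### Directed unions of subalgebras and limits of spectra -/

namespace Subalgebra

variable {K : Type u} [Field K] {A : Type u} [CommRing A]

section

variable [Algebra K A] {J : Type u} [Preorder J] (S : J → Subalgebra K A) (hS : Monotone S)

/-- The diagram of a monotone family of subalgebras. -/
@[simps]
def diagram : J ⥤ CommAlgCat.{u} K where
  obj j := .of K (S j)
  map f := CommAlgCat.ofHom (inclusion (hS f.le))

/-- The cocone over a monotone family of subalgebras given by the ambient algebra. -/
@[simps]
def diagramCocone : Cocone (diagram S hS) where
  pt := .of K A
  ι := { app := fun j => CommAlgCat.ofHom (S j).val }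

/-- The components of a cocone over a monotone family of subalgebras. -/
def coconeHom (s : Cocone (diagram S hS)) (j : J) : S j →ₐ[K] s.pt := (s.ι.app j).hom

variable [IsDirectedOrder J]

/-- The gluing lemma for unions asks for compatibility whenever `S i ≤ S j`, even if `i ≤ j` fails;
a common upper bound of `i` and `j` supplies it. -/
theorem coconeHom_eq_comp_inclusion (s : Cocone (diagram S hS)) (i j : J) (hij : S i ≤ S j) :
    coconeHom S hS s i = (coconeHom S hS s j).comp (inclusion hij) := by
  obtain ⟨k, hik, hjk⟩ := exists_ge_ge i j
  ext a
  have hi : coconeHom S hS s k (inclusion (hS hik) a) = coconeHom S hS s i a :=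
    congr(($(s.w (homOfLE hik))).hom a)
  have hj : coconeHom S hS s k (inclusion (hS hjk) (inclusion hij a)) =
      coconeHom S hS s j (inclusion hij a) :=
    congr(($(s.w (homOfLE hjk))).hom (inclusion hij a))
  exact hi.symm.trans hj

variable [Nonempty J] (h : ∀ a : A, ∃ j, a ∈ S j)

/-- The map from the ambient algebra induced by a cocone over a directed family of subalgebras that
covers it. -/
def coconeDesc (s : Cocone (diagram S hS)) : A →ₐ[K] s.pt :=
  (iSupLift S hS.directed_le (coconeHom S hS s) (coconeHom_eq_comp_inclusion S hS s) ⊤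
    fun a _ => (h a).elim fun j hj => le_iSup S j hj).comp (topEquiv (R := K) (A := A)).symm.toAlgHom

theorem coconeDesc_coe (s : Cocone (diagram S hS)) (j : J) (a : S j) :
    coconeDesc S hS h s a = coconeHom S hS s j a :=
  iSupLift_of_mem (dir := hS.directed_le) (hf := coconeHom_eq_comp_inclusion S hS s) S
    (⟨a, trivial⟩ : (⊤ : Subalgebra K A)) a.2

/-- An algebra is the colimit of a directed family of subalgebras that covers it. -/
def isColimitDiagramCocone : IsColimit (diagramCocone S hS) where
  desc s := CommAlgCat.ofHom (coconeDesc S hS h s)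
  fac s j := CommAlgCat.hom_ext (AlgHom.ext fun a => coconeDesc_coe S hS h s j a)
  uniq s m hm := CommAlgCat.hom_ext (AlgHom.ext fun a => by
    obtain ⟨j, hj⟩ := h a
    refine .trans ?_ (coconeDesc_coe S hS h s j ⟨a, hj⟩).symm
    exact congr(($(hm j)).hom ⟨a, hj⟩))

end

section

variable [HopfAlgebra K A] {J : Type u} [Preorder J] (S : J → Subalgebra K A) (hS : Monotone S)
  (hH : ∀ j, (S j).IsHopf)

/-- The diagram of a monotone family of Hopf subalgebras. -/
def hopfDiagram : J ⥤ CommHopfAlgCat.{u} K where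
  obj j := (hH j).toCommHopfAlgCat
  map {i j} f := (hH i).inclusionHom (hH j) (hS f.le)

/-- The cocone over a monotone family of Hopf subalgebras given by the ambient Hopf algebra. -/
def hopfDiagramCocone : Cocone (hopfDiagram S hS hH) where
  pt := .of K A
  ι := { app := fun j => (hH j).subtypeHom }

/-- The cone over the spectra of a monotone family of Hopf subalgebras given by the spectrum of the
ambient Hopf algebra. -/
def specDiagramCone : Cone ((hopfDiagram S hS hH).op ⋙ hopfSpec (.of K)) :=
  (hopfSpec (.of K)).mapCone (hopfDiagramCocone S hS hH).op

/-- The spectrum of a Hopf algebra is the limit of the spectra of a directed family of Hopf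
subalgebras that covers it. -/
def isLimitSpecDiagramCone [IsDirectedOrder J] [Nonempty J] (h : ∀ a : A, ∃ j, a ∈ S j) :
    IsLimit (specDiagramCone S hS hH) := by
  -- `Spec` sends the colimit of algebras to a limit of schemes over `Spec K`.
  have hpres : PreservesLimit (diagram S hS).op (algSpec (.of K)) :=
    (preservesLimitsOfSize_algSpec (R := .of K)).preservesLimitsOfShape.preservesLimit
  have hlim : IsLimit ((algSpec (.of K)).mapCone (diagramCocone S hS).op) :=
    isLimitOfPreserves (algSpec (.of K)) (isColimitDiagramCocone S hS h).op
  -- Forgetting the group and then the monoid structure reflects limits, so the limit may be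
  -- verified on underlying schemes over `Spec K`.
  refine isLimitOfReflects (Grp.forget₂Mon _) ?_
  refine isLimitOfReflects (Mon.forget _) ?_
  exact hlim

end

end Subalgebra

/-! ### Spectra of Hopf algebras: quotients, finite type, connectedness -/

namespace GroupSchemeOver

variable {K : Type u} [Field K] {A : Type u} [CommRing A] [HopfAlgebra K A]

/-- By naturality of `Γ(Spec B) ≅ B`, the map on global sections is `f` up to isomorphism. -/
theorem isQuotientMap_hopfSpec_map {B C : CommHopfAlgCat.{u} K} (f : B ⟶ C)
    (hf : Function.Injective f.hom) : IsQuotientMap ((hopfSpec (.of K)).map f.op) := by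
  let φ : CommRingCat.of B ⟶ CommRingCat.of C := CommRingCat.ofHom f.hom
  have hφ : Function.Injective (φ ≫ (Scheme.ΓSpecIso (.of C)).inv) :=
    (ConcreteCategory.bijective_of_isIso (Scheme.ΓSpecIso (.of C)).inv).1.comp hf
  rw [Scheme.ΓSpecIso_inv_naturality] at hφ
  have hs := (ConcreteCategory.bijective_of_isIso (Scheme.ΓSpecIso (.of B)).inv).2
  exact Function.Injective.of_comp_right hφ hs

theorem isAlgebraic_hopfSpec_obj (B : CommHopfAlgCat.{u} K) (h : Algebra.FiniteType K B) :
    IsAlgebraic ((hopfSpec (.of K)).obj (.op B)) where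
  affine := inferInstanceAs (IsAffine (Spec (.of B)))
  finiteType := by
    change LocallyOfFiniteType (Spec.map (CommRingCat.ofHom (algebraMap K B)))
    rw [HasRingHomProperty.Spec_iff (P := @LocallyOfFiniteType)]
    exact RingHom.finiteType_algebraMap.mpr h

/-- The affine scheme `G` is the spectrum of its global sections, which embed in `A`. -/
theorem connectedSpace_of_isQuotientMap [Nontrivial A]
    (h : ∀ e : A, IsIdempotentElem e → e = 0 ∨ e = 1) {G : GroupSchemeOver K}
    [IsAffine G.toScheme] (f : (hopfSpec (.of K)).obj (.op (.of K A)) ⟶ G) (hf : IsQuotientMap f) :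
    ConnectedSpace G.toScheme := by
  have : ConnectedSpace (PrimeSpectrum Γ(G.toScheme, ⊤)) :=
    PrimeSpectrum.connectedSpace_of_injective h
      ((Scheme.ΓSpecIso (.of A)).hom.hom.comp (schemeHom f).appTop.hom)
      (((ConcreteCategory.bijective_of_isIso (Scheme.ΓSpecIso (.of A)).hom).1).comp hf)
  exact (G.toScheme.isoSpec.hom.homeomorph.connectedSpace_iff).mpr this

/-- The spectrum of a commutative Hopf algebra without nontrivial idempotents that is covered by
its finitely generated Hopf subalgebras is pro-connected. -/
theorem isProConnected_hopfSpec_obj [Nontrivial A]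
    (h : ∀ e : A, IsIdempotentElem e → e = 0 ∨ e = 1)
    (hA : ∀ a : A, ∃ S : Subalgebra K A, S.IsHopf ∧ S.FG ∧ a ∈ S) :
    IsProConnected ((hopfSpec (.of K)).obj (.op (.of K A))) := by
  -- The index set consists of all finitely generated Hopf subalgebras, ordered by inclusion;
  -- suprema make it directed.
  let J := {S : Subalgebra K A // S.IsHopf ∧ S.FG}
  have hdir : IsDirectedOrder J :=
    ⟨fun S T => ⟨⟨S.1 ⊔ T.1, S.2.1.sup T.2.1, S.2.2.sup T.2.2⟩, le_sup_left (a := S.1),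
      le_sup_right (a := S.1)⟩⟩
  have hne : Nonempty J := by
    obtain ⟨S, hS, hfg, -⟩ := hA 0
    exact ⟨S, hS, hfg⟩
  have hmono : Monotone (Subtype.val : J → Subalgebra K A) := fun _ _ h => h
  refine ⟨J, inferInstance, hdir, hne,
    (Subalgebra.hopfDiagram Subtype.val hmono fun S => S.2.1).op ⋙ hopfSpec (.of K),
    (Subalgebra.specDiagramCone Subtype.val hmono fun S => S.2.1).π,
    ⟨Subalgebra.isLimitSpecDiagramCone _ _ _ fun a => ?_⟩, fun j => ⟨?_, ?_⟩, fun i j φ => ?_⟩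
  · obtain ⟨S, hS, hfg, ha⟩ := hA a
    exact ⟨⟨S, hS, hfg⟩, ha⟩
  · exact isAlgebraic_hopfSpec_obj j.unop.2.1.toCommHopfAlgCat ((Subalgebra.fg_iff_finiteType _).mp j.unop.2.2)
  · exact PrimeSpectrum.connectedSpace_of_injective h j.unop.1.val.toRingHom Subtype.val_injective
  · exact isQuotientMap_hopfSpec_map _ (Subalgebra.inclusion_injective φ.unop.le)

end GroupSchemeOver

end

theorem corollary4p4 (K : Type u) [Field K] [CharZero K] (L : Type u) [LieRing L] [LieAlgebra K L] :
    (∀ (G : GroupSchemeOver K) (f : affineEnvelope K L ⟶ G),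
      G.IsAlgebraic → GroupSchemeOver.IsQuotientMap f → ConnectedSpace G.toScheme) ∧
    (affineEnvelope K L).IsProConnected :=
  ⟨fun _ f hG hf =>
    have := hG.affine
    GroupSchemeOver.connectedSpace_of_isQuotientMap
      (fun _ => FiniteDual.eq_zero_or_one_of_isIdempotentElem K L) f hf,
  GroupSchemeOver.isProConnected_hopfSpec_obj
    (fun _ => FiniteDual.eq_zero_or_one_of_isIdempotentElem K L)
    (FiniteDual.exists_isHopf_fg_mem K L)⟩
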